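/- Let $n \ge 2$ and let $k, t$ be positive integers with $k + t \le n$. Let $X_1, \dots, X_n$ be independent exponential random variables with a common parameter $c > 0$, and let $U_1, \dots, U_n$ be independent random variables uniformly distributed on $[0,1]$ (possibly on another probability space). Let $X_{(1)} \le \dots \le X_{(n)}$ and $U_{(1)} \le \dots \le U_{(n)}$ be the corresponding order statistics, i.e. the samples rearranged in nondecreasing order, and write $\operatorname{Corr}(Y,Z) = \operatorname{Cov}(Y,Z)/\sqrt{\operatorname{Var}(Y)\operatorname{Var}(Z)}$ for the correlation coefficient. Then $X_{(k)}, X_{(k+t)}, U_{(k)}, U_{(k+t)}$ are square-integrable with positive variance (so that the correlation coefficients are defined), and $$\operatorname{Corr}\bigl(X_{(k)}, X_{(k+t)}\bigr) < \operatorname{Corr}\bigl(U_{(k)}, U_{(k+t)}\bigr) = \sqrt{\frac{k\,(n+1-k-t)}{(k+t)\,(n+1-k)}}.$$ -/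

import Mathlib

open MeasureTheory ProbabilityTheory

/-- The `k`-th order statistic `X_(k)` (`1 ≤ k ≤ n`, counted from the smallest) of the real random
variables `X_1, …, X_n`: its value at `ω` is the `k`-th entry of the sample `X_1 ω, …, X_n ω`
rearranged in nondecreasing order. -/
noncomputable def orderStatistic {Ω : Type*} {n : ℕ} (X : Fin n → Ω → ℝ) (k : ℕ) (hk : 1 ≤ k) (hkn : k ≤ n) :
    Ω → ℝ :=
  fun ω => X (Tuple.sort (fun i => X i ω) ⟨k - 1, Nat.sub_one_lt_of_le hk hkn⟩) ω

/-- The (Pearson) correlation coefficient of two real random variables. It is meaningful if both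
are square-integrable with nonzero variance. -/
noncomputable def correlationCoefficient {Ω : Type*} [MeasurableSpace Ω] (Y Z : Ω → ℝ)
    (μ : Measure Ω) : ℝ :=
  covariance Y Z μ / (Real.sqrt (variance Y μ) * Real.sqrt (variance Z μ))

/-- `Y` is square-integrable with nonzero variance, so that its correlation coefficients
make sense. -/
def HasPositiveFiniteVariance {Ω : Type*} [MeasurableSpace Ω] (Y : Ω → ℝ) (μ : Measure Ω) : Prop :=
  MemLp Y 2 μ ∧ 0 < variance Y μ

/-! By Rényi's representation (`map_sortedSample_expMeasure`), a sorted sample of n exponentials of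
rate c is distributed as the partial sums of independent spacings, the j-th of which (counted from
0) is exponential of rate (n - j)c. Hence for k ≤ l the covariance of X_(k) and X_(l) equals Var
X_(k) = a_k / c², where a_k = ∑_{j<k} 1/(n - j)² (`expOrderVariance`). The rate cancels and the
correlation is √(a_k / a_l).

The map x ↦ 1 - exp(-x) is increasing and carries the rate-one exponential law to the uniform law.
So the U_(k) are jointly distributed as 1 - exp(-S_k), with S_k the sum of the first k spacings for
c = 1. Products of Laplace transforms telescope, giving the covariance k(n+1-l)/((n+1)²(n+2)) for k
≤ l and thus the closed form of the uniform correlation.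

After squaring, the inequality says that a_k (n+1-k)/k is strictly increasing in k
(`expOrderVariance_mul_lt`). A single step of this monotonicity is equivalent to a_k <
k/((n-k)(n+1)), which is `expOrderVariance_lt`, proved by induction on k. -/

/-- Tonelli's theorem for a product of functions of the single coordinates. -/
theorem lintegral_fin_prod_eq_prod {n : ℕ} {E : Fin n → Type*}
    {mE : ∀ i, MeasurableSpace (E i)} {μ : (i : Fin n) → Measure (E i)} [∀ i, SigmaFinite (μ i)]
    {f : (i : Fin n) → E i → ENNReal} (hf : ∀ i, Measurable (f i)) :
    ∫⁻ x : (i : Fin n) → E i, ∏ i, f i (x i) ∂(Measure.pi μ) = ∏ i, ∫⁻ x, f i x ∂(μ i) := by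
  induction n with
  | zero => simp
  | succ n n_ih =>
      calc
        _ = ∫⁻ x : E 0 × ((i : Fin n) → E (Fin.succ i)),
            f 0 x.1 * ∏ i : Fin n, f (Fin.succ i) (x.2 i)
            ∂((μ 0).prod (Measure.pi (fun i ↦ μ i.succ))) := by
          rw [← ((measurePreserving_piFinSuccAbove μ 0).symm).lintegral_comp_emb
            (MeasurableEquiv.measurableEmbedding _)]
          refine lintegral_congr fun x => ?_
          rw [Fin.prod_univ_succ]
          rfl
        _ = (∫⁻ x, f 0 x ∂μ 0)
            * ∏ i : Fin n, ∫⁻ (x : E (Fin.succ i)), f (Fin.succ i) x ∂(μ i.succ) := by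
          rw [← n_ih fun i => hf _, ← lintegral_prod_mul (hf 0).aemeasurable]
          exact (Finset.measurable_prod _ fun i _ =>
            (hf i.succ).comp (measurable_pi_apply i)).aemeasurable
        _ = ∏ i, ∫⁻ x, f i x ∂(μ i) := by rw [Fin.prod_univ_succ]

theorem pi_withDensity {n : ℕ} (f : Fin n → ℝ → ENNReal) (hf : ∀ i, Measurable (f i))
    [∀ i, SigmaFinite ((volume : Measure ℝ).withDensity (f i))] :
    Measure.pi (fun i => (volume : Measure ℝ).withDensity (f i)) =
      (volume : Measure (Fin n → ℝ)).withDensity (fun x => ∏ i, f i (x i)) := by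
  refine Measure.pi_eq fun s hs => ?_
  rw [withDensity_apply _ (MeasurableSet.univ_pi hs), volume_pi, Measure.restrict_pi_pi,
    lintegral_fin_prod_eq_prod hf]
  exact Finset.prod_congr rfl fun i _ => (withDensity_apply _ (hs i)).symm

/-! ### Sorting a sample: measurability and exchangeability -/

/-- The sample `x` rearranged in nondecreasing order. -/
noncomputable def sortedSample {n : ℕ} (x : Fin n → ℝ) : Fin n → ℝ := x ∘ Tuple.sort x

theorem measurableSet_monotone_comp {n : ℕ} (σ : Equiv.Perm (Fin n)) :
    MeasurableSet {x : Fin n → ℝ | Monotone (x ∘ σ)} := by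
  have : {x : Fin n → ℝ | Monotone (x ∘ σ)} =
      ⋂ i, ⋂ j, ⋂ (_ : i ≤ j), {x | x (σ i) ≤ x (σ j)} := by
    ext x; simp [Monotone]
  rw [this]
  exact .iInter fun i => .iInter fun j => .iInter fun _ =>
    measurableSet_le (measurable_pi_apply _) (measurable_pi_apply _)

/-- `Tuple.sort` breaks ties by index, so σ is the sorting permutation iff x ∘ σ is monotone and
equal values keep their index order. These are finitely many measurable conditions. -/
theorem measurableSet_sort_eq {n : ℕ} (σ : Equiv.Perm (Fin n)) :
    MeasurableSet {x : Fin n → ℝ | Tuple.sort x = σ} := by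
  have : {x : Fin n → ℝ | Tuple.sort x = σ} = {x | Monotone (x ∘ σ)} ∩
      ⋂ i, ⋂ j, ⋂ (_ : i < j), ⋂ (_ : ¬ σ i < σ j), {x | x (σ i) = x (σ j)}ᶜ := by
    ext x
    simp only [Set.mem_ofPred_eq, eq_comm (b := σ), Tuple.eq_sort_iff]
    simp only [Set.mem_inter_iff, Set.mem_iInter, Set.mem_ofPred_eq, Set.mem_compl_iff]
    exact and_congr_right fun _ => ⟨fun h i j hij h1 h2 => h1 (h i j hij h2),
      fun h i j hij h2 => by_contra fun h1 => h i j hij h1 h2⟩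
  rw [this]
  exact (measurableSet_monotone_comp σ).inter (.iInter fun i => .iInter fun j => .iInter fun _ =>
    .iInter fun _ => (measurableSet_eq_fun (f := fun x : Fin n → ℝ => x (σ i))
      (g := fun x => x (σ j)) (measurable_pi_apply _) (measurable_pi_apply _)).compl)

theorem measurable_comp_perm {n : ℕ} (σ : Equiv.Perm (Fin n)) :
    Measurable fun x : Fin n → ℝ => x ∘ σ :=
  measurable_pi_lambda _ fun _ => measurable_pi_apply _

theorem preimage_sortedSample {n : ℕ} (B : Set (Fin n → ℝ)) :
    sortedSample ⁻¹' B = ⋃ σ, {x | Tuple.sort x = σ} ∩ {x | x ∘ σ ∈ B} := by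
  ext x; simp [sortedSample]

theorem measurable_sortedSample {n : ℕ} : Measurable (sortedSample (n := n)) := by
  intro B hB
  rw [preimage_sortedSample]
  exact .iUnion fun σ => (measurableSet_sort_eq σ).inter (measurable_comp_perm σ hB)

theorem pi_map_comp_perm {n : ℕ} (μ : Measure ℝ) [SigmaFinite μ] (σ : Equiv.Perm (Fin n)) :
    (Measure.pi fun _ : Fin n => μ).map (fun x => x ∘ σ) = Measure.pi fun _ => μ := by
  refine (Measure.pi_eq fun s hs => ?_).symm
  rw [Measure.map_apply (measurable_comp_perm σ) (MeasurableSet.univ_pi hs)]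
  have : (fun x : Fin n → ℝ => x ∘ σ) ⁻¹' Set.univ.pi s = Set.univ.pi fun i => s (σ.symm i) := by
    ext x
    simp only [Set.mem_preimage, Set.mem_pi, Set.mem_univ, true_imp_iff, Function.comp_apply]
    exact ⟨fun h i => by simpa using h (σ.symm i), fun h i => by simpa using h (σ i)⟩
  rw [this, Measure.pi_pi, Equiv.prod_comp σ.symm fun i => μ (s i)]

/-- A tie x i = x j confines x to a proper subspace, which is Lebesgue-null. -/
theorem ae_injective {n : ℕ} : ∀ᵐ x : Fin n → ℝ, Function.Injective x := by
  have h : ∀ i j : Fin n, i ≠ j → ∀ᵐ x : Fin n → ℝ, x i ≠ x j := by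
    intro i j hij
    have := Measure.addHaar_submodule (volume : Measure (Fin n → ℝ))
      (LinearMap.ker (LinearMap.proj (R := ℝ) (φ := fun _ : Fin n => ℝ) i - LinearMap.proj j)) (by
        intro h
        have : Pi.single i (1 : ℝ) ∈ (⊤ : Submodule ℝ (Fin n → ℝ)) := trivial
        rw [← h] at this
        simp [hij.symm] at this)
    rw [ae_iff]
    convert! this using 2
    ext x
    simp [sub_eq_zero]
  have : ∀ᵐ x : Fin n → ℝ, ∀ i j : Fin n, i ≠ j → x i ≠ x j :=
    ae_all_iff.2 fun i => ae_all_iff.2 fun j => by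
      by_cases hij : i = j
      · simp [hij]
      · filter_upwards [h i j hij] with x hx _ using hx
  filter_upwards [this] with x hx i j hij
  exact by_contra fun hne => hx i j hne hij

/-- The sets where a given σ sorts x partition the space into n! cells. Up to ties, which are null,
each cell is the preimage of the monotone cone under permuting coordinates, and this permutation
preserves the measure. -/
theorem pi_preimage_sortedSample {n : ℕ} (μ : Measure ℝ) [SigmaFinite μ]
    (hμ : Measure.pi (fun _ : Fin n => μ) ≪ volume) {B : Set (Fin n → ℝ)} (hB : MeasurableSet B) :
    Measure.pi (fun _ : Fin n => μ) (sortedSample ⁻¹' B) =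
      n.factorial * Measure.pi (fun _ : Fin n => μ) ({x | Monotone x} ∩ B) := by
  have hM : MeasurableSet {x : Fin n → ℝ | Monotone x} :=
    measurableSet_monotone_comp (Equiv.refl _)
  rw [preimage_sortedSample, measure_iUnion]
  · rw [tsum_fintype, Finset.sum_congr rfl (g := fun _ =>
      Measure.pi (fun _ : Fin n => μ) ({x | Monotone x} ∩ B))]
    · simp [Fintype.card_perm]
    · intro σ _
      have h1 := Measure.map_apply (μ := Measure.pi fun _ : Fin n => μ) (measurable_comp_perm σ)
        (hM.inter hB)
      rw [pi_map_comp_perm] at h1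
      rw [h1]
      refine measure_congr ?_
      filter_upwards [hμ.ae_le ae_injective] with x hx
      refine propext ?_
      change Tuple.sort x = σ ∧ x ∘ σ ∈ B ↔ Monotone (x ∘ σ) ∧ x ∘ σ ∈ B
      rw [eq_comm, Tuple.eq_sort_iff]
      refine and_congr_left fun _ => and_iff_left ?_
      exact fun i j hij h => absurd (σ.injective (hx h)) hij.ne
  · intro σ τ hστ
    exact Set.disjoint_left.2 fun x hx hy => hστ (hx.1.symm.trans hy.1)
  · exact fun σ => (measurableSet_sort_eq σ).inter (measurable_comp_perm σ hB)

/-! ### Partial sums and Rényi's representation -/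

/-- The partial sums `d 0 + ⋯ + d i`. -/
noncomputable def partialSums {n : ℕ} (d : Fin n → ℝ) (i : Fin n) : ℝ := ∑ j ∈ Finset.Iic i, d j

/-- The matrix is lower triangular with unit diagonal, hence of determinant 1. -/
theorem measurePreserving_partialSums {n : ℕ} :
    MeasurePreserving (partialSums (n := n)) := by
  let M : Matrix (Fin n) (Fin n) ℝ := Matrix.of fun i j => if j ≤ i then 1 else 0
  have hM : M.det = 1 := by
    rw [Matrix.det_of_isLowerTriangular]
    · simp [M]
    · intro i j hij
      have : i < j := hij
      simp [M, this]
  have hL : (partialSums (n := n)) = Matrix.toLin' M := by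
    ext d i
    simp [M, partialSums, Matrix.mulVec, dotProduct, Finset.sum_ite, Finset.filter_ge_eq_Iic]
  rw [hL]
  refine ⟨(LinearMap.continuous_on_pi _).measurable, ?_⟩
  rw [Real.map_matrix_volume_pi_eq_smul_volume_pi (by simp [hM]), hM]
  simp

theorem sum_partialSums {n : ℕ} (d : Fin n → ℝ) :
    ∑ i, partialSums d i = ∑ j : Fin n, ((n : ℝ) - (j : ℕ)) * d j := by
  simp only [partialSums]
  -- Each d j occurs in the n - j partial sums whose index is at least j.
  rw [Finset.sum_comm' (t' := Finset.univ) (s' := fun j => Finset.Ici j) (by simp)]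
  refine Finset.sum_congr rfl fun j _ => ?_
  simp [Nat.cast_sub j.2.le]

theorem prod_natCast_sub {n : ℕ} : ∏ j : Fin n, ((n : ℝ) - (j : ℕ)) = n.factorial := by
  rw [Fin.prod_univ_eq_prod_range (fun j => (n : ℝ) - (j : ℕ)), ← Finset.prod_range_reflect,
    ← Finset.prod_range_add_one_eq_factorial, Nat.cast_prod]
  refine Finset.prod_congr rfl fun j hj => ?_
  have := Finset.mem_range.1 hj
  rw [show n - 1 - j = n - (j + 1) by omega, Nat.cast_sub (by omega)]
  ring

theorem monotone_partialSums {n : ℕ} {d : Fin n → ℝ} (hd : ∀ j, 0 ≤ d j) :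
    Monotone (partialSums d) := fun _ _ hij =>
  Finset.sum_le_sum_of_subset_of_nonneg (Finset.Iic_subset_Iic.2 hij) fun k _ _ => hd k

theorem nonneg_of_monotone_partialSums {n : ℕ} {d : Fin n → ℝ} (hm : Monotone (partialSums d))
    (h0 : ∀ i, 0 ≤ partialSums d i) (j : Fin n) : 0 ≤ d j := by
  obtain ⟨j, hj⟩ := j
  cases j with
  | zero =>
    have h := h0 ⟨0, hj⟩
    have : Finset.Iic (⟨0, hj⟩ : Fin n) = {⟨0, hj⟩} := by
      ext i; simp [Fin.le_def, Fin.ext_iff]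
    simpa [partialSums, this] using h
  | succ m =>
    have hm' : m < n := by omega
    have h := hm (show (⟨m, hm'⟩ : Fin n) ≤ ⟨m + 1, hj⟩ by simp)
    have : Finset.Iic (⟨m + 1, hj⟩ : Fin n) = insert ⟨m + 1, hj⟩ (Finset.Iic ⟨m, hm'⟩) := by
      ext i; simp [Fin.le_def, Fin.ext_iff]; omega
    rw [partialSums, partialSums, this, Finset.sum_insert (by simp [Fin.le_def])] at h
    linarith

theorem measurable_exponentialPDF (r : ℝ) : Measurable (exponentialPDF r) :=
  (measurable_exponentialPDFReal r).ennreal_ofReal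

/-- This is Rényi's representation at the level of densities. For nonnegative d the exponents agree
by `sum_partialSums`, and the rates multiply to n! cⁿ. -/
theorem exponentialPDF_prod_partialSums {n : ℕ} {c : ℝ} (hc : 0 < c) (d : Fin n → ℝ) :
    ∏ j : Fin n, exponentialPDF (((n : ℝ) - (j : ℕ)) * c) (d j) =
      n.factorial * {x : Fin n → ℝ | Monotone x}.indicator
        (fun x => ∏ i, exponentialPDF c (x i)) (partialSums d) := by
  have hr : ∀ j : Fin n, 0 < ((n : ℝ) - (j : ℕ)) := fun j =>
    sub_pos.2 (Nat.cast_lt.2 j.2)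
  by_cases hd : ∀ j, 0 ≤ d j
  · have hp : ∀ i, 0 ≤ partialSums d i := fun i => Finset.sum_nonneg fun j _ => hd j
    rw [Set.indicator_of_mem (by exact monotone_partialSums hd)]
    simp only [exponentialPDF_of_nonneg (hd _), exponentialPDF_of_nonneg (hp _)]
    rw [← ENNReal.ofReal_prod_of_nonneg (fun j _ => by have := hr j; positivity),
      ← ENNReal.ofReal_prod_of_nonneg (fun j _ => by positivity),
      ← ENNReal.ofReal_natCast, ← ENNReal.ofReal_mul (by positivity)]
    congr 1
    simp only [Finset.prod_mul_distrib, ← Real.exp_sum, prod_natCast_sub, Finset.sum_neg_distrib,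
      ← Finset.mul_sum, sum_partialSums]
    rw [mul_assoc, Finset.mul_sum]
    simp only [mul_left_comm c, mul_assoc]
  · obtain ⟨j, hj⟩ := not_forall.1 hd
    rw [Finset.prod_eq_zero (Finset.mem_univ j) (exponentialPDF_of_neg (not_le.1 hj))]
    symm
    -- With a negative spacing the right side vanishes too: either the partial sums leave the
    -- monotone cone, or one of them is negative and its density is 0.
    by_cases hm : Monotone (partialSums d)
    · rw [Set.indicator_of_mem (by exact hm)]
      have : ∃ i, ¬ 0 ≤ partialSums d i := by
        by_contra! h
        exact hj (nonneg_of_monotone_partialSums hm h j)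
      obtain ⟨i, hi⟩ := this
      rw [Finset.prod_eq_zero (Finset.mem_univ i) (exponentialPDF_of_neg (not_le.1 hi)), mul_zero]
    · rw [Set.indicator_of_notMem (by exact hm), mul_zero]

/-- The common law of the spacings of a sorted exponential sample. -/
noncomputable def expSpacings (n : ℕ) (c : ℝ) : Measure (Fin n → ℝ) :=
  Measure.pi fun j : Fin n => expMeasure (((n : ℝ) - (j : ℕ)) * c)

theorem expRate_pos {n : ℕ} {c : ℝ} (hc : 0 < c) (j : Fin n) : 0 < ((n : ℝ) - (j : ℕ)) * c :=
  mul_pos (sub_pos.2 (Nat.cast_lt.2 j.2)) hc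

theorem isProbabilityMeasure_expSpacings (n : ℕ) {c : ℝ} (hc : 0 < c) :
    IsProbabilityMeasure (expSpacings n c) := by
  have := fun j : Fin n => isProbabilityMeasure_expMeasure (expRate_pos hc j)
  unfold expSpacings
  infer_instance

theorem pi_expMeasure {n : ℕ} {r : Fin n → ℝ} (hr : ∀ i, 0 < r i) :
    Measure.pi (fun i => expMeasure (r i)) =
      (volume : Measure (Fin n → ℝ)).withDensity (fun x => ∏ i, exponentialPDF (r i) (x i)) := by
  have : ∀ i, SigmaFinite ((volume : Measure ℝ).withDensity (exponentialPDF (r i))) := fun i => by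
    have := isProbabilityMeasure_expMeasure (hr i)
    exact inferInstanceAs (SigmaFinite (expMeasure (r i)))
  exact pi_withDensity (fun i => exponentialPDF (r i)) fun i => measurable_exponentialPDF _

/-- Rényi's representation of the order statistics of an exponential sample. -/
theorem map_sortedSample_expMeasure (n : ℕ) {c : ℝ} (hc : 0 < c) :
    (Measure.pi fun _ : Fin n => expMeasure c).map sortedSample =
      (expSpacings n c).map partialSums := by
  have := isProbabilityMeasure_expMeasure hc
  have hM : MeasurableSet {x : Fin n → ℝ | Monotone x} :=
    measurableSet_monotone_comp (Equiv.refl _)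
  have hL := measurePreserving_partialSums (n := n)
  have hp : Measurable fun x : Fin n → ℝ => ∏ i, exponentialPDF c (x i) :=
    Finset.measurable_prod _ fun i _ =>
      (measurable_exponentialPDF c).comp (measurable_pi_apply i)
  ext B hB
  rw [Measure.map_apply measurable_sortedSample hB, Measure.map_apply hL.measurable hB,
    pi_preimage_sortedSample _ _ hB, expSpacings, pi_expMeasure fun _ => hc,
    pi_expMeasure (expRate_pos hc), withDensity_apply _ (hM.inter hB),
    withDensity_apply _ (hL.measurable hB)]
  · simp only [exponentialPDF_prod_partialSums hc]
    rw [hL.setLIntegral_comp_preimage hB ((hp.indicator hM).const_mul _),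
      lintegral_const_mul _ (hp.indicator hM), setLIntegral_indicator hM]
  · rw [pi_expMeasure fun _ => hc]
    exact withDensity_absolutelyContinuous _ _

/-! ### Moments of the exponential law and its transport to the uniform law -/

theorem integral_expMeasure {r : ℝ} (hr : 0 < r) (f : ℝ → ℝ) :
    ∫ x, f x ∂expMeasure r = r * ∫ x in Set.Ioi 0, Real.exp (-(r * x)) * f x := by
  have h : ∫ x, f x ∂expMeasure r = ∫ x, (exponentialPDF r x).toReal • f x :=
    integral_withDensity_eq_integral_toReal_smul (measurable_exponentialPDF r)
      (Filter.Eventually.of_forall fun x => ENNReal.ofReal_lt_top) f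
  rw [h, ← integral_const_mul, ← integral_Ici_eq_integral_Ioi,
    ← integral_indicator measurableSet_Ici]
  refine integral_congr_ae (Filter.Eventually.of_forall fun x => ?_)
  simp only [smul_eq_mul]
  by_cases hx : 0 ≤ x
  · rw [exponentialPDF_of_nonneg hx, ENNReal.toReal_ofReal (by positivity),
      Set.indicator_of_mem (by exact hx), mul_assoc]
  · rw [exponentialPDF_of_neg (not_le.1 hx), Set.indicator_of_notMem (by exact hx)]
    simp

theorem integral_pow_expMeasure {r : ℝ} (hr : 0 < r) (m : ℕ) :
    ∫ x, x ^ m ∂expMeasure r = m.factorial / r ^ m := by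
  have h := Real.integral_rpow_mul_exp_neg_mul_Ioi (a := m + 1) (by positivity) hr
  rw [Real.Gamma_nat_eq_factorial, ← Nat.cast_succ, Real.rpow_natCast] at h
  rw [integral_expMeasure hr, show (∫ x in Set.Ioi 0, Real.exp (-(r * x)) * x ^ m) =
    ∫ x in Set.Ioi 0, x ^ (((m.succ : ℕ) : ℝ) - 1) * Real.exp (-(r * x)) from ?_, h]
  · rw [pow_succ, one_div, inv_pow]
    field_simp
  · simp [mul_comm]

theorem integral_exp_neg_expMeasure {r a : ℝ} (hr : 0 < r) (ha : 0 ≤ a) :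
    ∫ x, Real.exp (-(a * x)) ∂expMeasure r = r / (r + a) := by
  have h := integral_exp_mul_Ioi (a := -(r + a)) (by linarith) 0
  rw [integral_expMeasure hr, show (∫ x in Set.Ioi 0, Real.exp (-(r * x)) * Real.exp (-(a * x))) =
    ∫ x in Set.Ioi 0, Real.exp (-(r + a) * x) from ?_, h]
  · have : r + a ≠ 0 := by positivity
    simp only [mul_zero, Real.exp_zero]
    field_simp
  · refine integral_congr_ae (Filter.Eventually.of_forall fun x => ?_)
    simp only [← Real.exp_add]
    congr 1; ring

theorem memLp_id_expMeasure {r : ℝ} (hr : 0 < r) : MemLp id 2 (expMeasure r) := by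
  rw [memLp_two_iff_integrable_sq measurable_id.aestronglyMeasurable]
  -- A non-integrable function has integral 0 by convention, but the second moment was computed to
  -- be positive.
  refine by_contra fun h => ?_
  have := integral_pow_expMeasure hr 2
  simp only [id] at h
  rw [integral_undef h] at this
  have : 0 < ((Nat.factorial 2 : ℕ) : ℝ) / r ^ 2 := by positivity
  linarith

theorem variance_expMeasure {r : ℝ} (hr : 0 < r) : variance id (expMeasure r) = 1 / r ^ 2 := by
  have := isProbabilityMeasure_expMeasure hr
  have h1 := integral_pow_expMeasure hr 1
  have h2 := integral_pow_expMeasure hr 2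
  rw [variance_eq_sub (memLp_id_expMeasure hr)]
  simp only [Pi.pow_apply, id]
  simp only [pow_one] at h1
  rw [h1, h2]
  simp [Nat.factorial]
  field_simp
  norm_num

/-- Probability integral transform: the map is the distribution function of the rate-one law on the
positive axis. The two laws are compared on the half-lines `Iic y`. -/
theorem map_expMeasure_one_eq_uniform :
    (expMeasure 1).map (fun x => 1 - Real.exp (-x)) = volume.restrict (Set.Icc (0 : ℝ) 1) := by
  have := isProbabilityMeasure_expMeasure one_pos
  have hg : Measurable fun x : ℝ => 1 - Real.exp (-x) := by fun_prop
  have : IsProbabilityMeasure ((expMeasure 1).map fun x => 1 - Real.exp (-x)) :=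
    Measure.isProbabilityMeasure_map hg.aemeasurable
  refine Measure.ext_of_Iic _ _ fun y => ?_
  rw [Measure.map_apply hg measurableSet_Iic, Measure.restrict_apply measurableSet_Iic]
  rcases lt_or_ge y 1 with hy | hy
  · have h1 : (fun x : ℝ => 1 - Real.exp (-x)) ⁻¹' Set.Iic y = Set.Iic (-Real.log (1 - y)) := by
      ext x
      simp only [Set.mem_preimage, Set.mem_Iic]
      rw [sub_le_comm, ← Real.log_le_iff_le_exp (by linarith), le_neg]
    have h2 : Set.Iic y ∩ Set.Icc 0 1 = Set.Icc 0 y := by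
      ext x
      simp only [Set.mem_inter_iff, Set.mem_Iic, Set.mem_Icc]
      exact ⟨fun h => ⟨h.2.1, h.1⟩, fun h => ⟨h.2, h.1, by linarith [h.2]⟩⟩
    rw [h1, h2, Real.volume_Icc, sub_zero, expMeasure, gammaMeasure,
      withDensity_apply _ measurableSet_Iic]
    refine (lintegral_exponentialPDF_eq_antiDeriv one_pos _).trans ?_
    split_ifs with h
    · rw [one_mul, neg_neg, Real.exp_log (by linarith)]
      congr 1; ring
    · rw [ENNReal.ofReal_of_nonpos (le_refl 0), ENNReal.ofReal_of_nonpos]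
      by_contra! hy0
      exact h (neg_nonneg.2 (Real.log_nonpos (by linarith) (by linarith)))
  · have h1 : (fun x : ℝ => 1 - Real.exp (-x)) ⁻¹' Set.Iic y = Set.univ := by
      ext x
      simp only [Set.mem_preimage, Set.mem_Iic, Set.mem_univ, iff_true]
      linarith [Real.exp_pos (-x)]
    have h2 : Set.Iic y ∩ Set.Icc 0 1 = Set.Icc 0 1 :=
      Set.inter_eq_right.2 fun x hx => hx.2.trans hy
    rw [h1, h2]
    simp

/-! ### Covariances of sums of spacings and of their exponentials -/

/-- The sum of the first `k` entries of `d`. -/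
noncomputable def initialSum {n : ℕ} (k : ℕ) (d : Fin n → ℝ) : ℝ :=
  ∑ j ∈ Finset.univ.filter fun j : Fin n => (j : ℕ) < k, d j

theorem partialSums_eq_initialSum {n k : ℕ} (hk : 1 ≤ k) (hkn : k - 1 < n) (d : Fin n → ℝ) :
    partialSums d ⟨k - 1, hkn⟩ = initialSum k d := by
  unfold partialSums initialSum
  congr 1
  ext j
  simp only [Finset.mem_Iic, Fin.le_def, Finset.mem_filter, Finset.mem_univ, true_and]
  omega

theorem measurable_initialSum {n : ℕ} (k : ℕ) : Measurable (initialSum (n := n) k) :=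
  Finset.measurable_sum _ fun j _ => measurable_pi_apply j

theorem memLp_eval_expSpacings {n : ℕ} {c : ℝ} (hc : 0 < c) (j : Fin n) :
    MemLp (fun d : Fin n → ℝ => d j) 2 (expSpacings n c) := by
  have := fun j : Fin n => isProbabilityMeasure_expMeasure (expRate_pos hc j)
  exact (memLp_id_expMeasure (expRate_pos hc j)).comp_measurePreserving
    (measurePreserving_eval (fun j : Fin n => expMeasure (((n : ℝ) - (j : ℕ)) * c)) j)

theorem memLp_initialSum {n : ℕ} {c : ℝ} (hc : 0 < c) (k : ℕ) :
    MemLp (initialSum (n := n) k) 2 (expSpacings n c) :=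
  memLp_finsetSum _ fun j _ => memLp_eval_expSpacings hc j

theorem covariance_eval_expSpacings {n : ℕ} {c : ℝ} (hc : 0 < c) (i j : Fin n) :
    covariance (fun d : Fin n → ℝ => d i) (fun d => d j) (expSpacings n c) =
      if i = j then 1 / (((n : ℝ) - (i : ℕ)) * c) ^ 2 else 0 := by
  have := fun j : Fin n => isProbabilityMeasure_expMeasure (expRate_pos hc j)
  have := isProbabilityMeasure_expSpacings n hc
  split_ifs with h
  · subst h
    have hl : HasLaw (fun d : Fin n → ℝ => d i) (expMeasure (((n : ℝ) - (i : ℕ)) * c))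
        (expSpacings n c) :=
      (measurePreserving_eval (fun j : Fin n => expMeasure (((n : ℝ) - (j : ℕ)) * c)) i).hasLaw
    rw [covariance_self (measurable_pi_apply i).aemeasurable, hl.variance_eq,
      variance_expMeasure (expRate_pos hc i)]
  · have hi : iIndepFun (fun (i : Fin n) (d : Fin n → ℝ) => d i) (expSpacings n c) :=
      iIndepFun_pi (X := fun _ x => x) fun _ => aemeasurable_id
    exact (hi.indepFun h).covariance_eq_zero (memLp_eval_expSpacings hc i)
      (memLp_eval_expSpacings hc j)

/-- By independence only the spacings common to both sums contribute, namely the first k. -/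
theorem covariance_initialSum {n k l : ℕ} {c : ℝ} (hc : 0 < c) (hkl : k ≤ l) (hl : l ≤ n) :
    covariance (initialSum (n := n) k) (initialSum l) (expSpacings n c) =
      (∑ j ∈ Finset.range k, 1 / ((n : ℝ) - j) ^ 2) / c ^ 2 := by
  have := isProbabilityMeasure_expSpacings n hc
  unfold initialSum
  rw [covariance_fun_sum_fun_sum' (fun j _ => memLp_eval_expSpacings hc j)
    fun j _ => memLp_eval_expSpacings hc j]
  simp only [covariance_eval_expSpacings hc, Finset.sum_ite_eq, Finset.mem_filter,
    Finset.mem_univ, true_and]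
  rw [Finset.sum_div]
  have h1 : (Finset.range k) = (Finset.range n).filter (· < k) := by
    ext j; simp only [Finset.mem_range, Finset.mem_filter]; omega
  rw [h1, Finset.sum_filter, Finset.sum_filter, ← Fin.sum_univ_eq_sum_range
    (fun j => if j < k then 1 / ((n : ℝ) - j) ^ 2 / c ^ 2 else 0)]
  refine Finset.sum_congr rfl fun j _ => ?_
  split_ifs
  · rw [mul_pow, div_div]
  · omega
  · rfl

/-- The factors are (n-x)/(n-x+2) for x < k, (n-x)/(n-x+1) for k ≤ x < l, and 1 afterwards, so the
product telescopes. The truncation m is free so that induction can pass through the three ranges. -/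
theorem prod_range_exp_transform {n k l : ℕ} (hkl : k ≤ l) {m : ℕ} (hm : m ≤ n) :
    ∏ x ∈ Finset.range m, ((n : ℝ) - x) / ((n : ℝ) - x +
        ((if x < k then 1 else 0) + (if x < l then 1 else 0))) =
      ((n : ℝ) + 1 - (min m l : ℕ)) * ((n : ℝ) + 2 - (min m k : ℕ)) / ((n + 1) * (n + 2)) := by
  induction m with
  | zero => simp; field_simp
  | succ m ih =>
    have hmn : (m : ℝ) + 1 ≤ n := by exact_mod_cast hm
    have h0 : (n : ℝ) - m ≠ 0 := by linarith
    have h1 : (n : ℝ) - m + 1 ≠ 0 := by linarith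
    have h2 : (n : ℝ) - m + 2 ≠ 0 := by linarith
    rw [Finset.prod_range_succ, ih (by omega)]
    rcases lt_or_ge m k with h | h
    · rw [if_pos h, if_pos (by omega), min_eq_left (by omega), min_eq_left (by omega),
        min_eq_left (by omega), min_eq_left (by omega)]
      push_cast
      norm_num
      field_simp
      ring
    rcases lt_or_ge m l with h' | h'
    · rw [if_neg (by omega), if_pos h', min_eq_left (by omega), min_eq_right (by omega),
        min_eq_left (by omega), min_eq_right (by omega)]
      push_cast
      norm_num
      field_simp
      ring
    · rw [if_neg (by omega), if_neg (by omega), min_eq_right (by omega), min_eq_right (by omega),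
        min_eq_right (by omega), min_eq_right (by omega), add_zero, add_zero, div_self h0, mul_one]

theorem integral_exp_neg_initialSum {n k l : ℕ} (hkl : k ≤ l) (hl : l ≤ n) :
    ∫ d : Fin n → ℝ, Real.exp (-(initialSum k d)) * Real.exp (-(initialSum l d))
        ∂expSpacings n 1 =
      ((n : ℝ) + 1 - l) * ((n : ℝ) + 2 - k) / ((n + 1) * (n + 2)) := by
  have := fun j : Fin n => isProbabilityMeasure_expMeasure (expRate_pos one_pos j)
  have h : ∀ d : Fin n → ℝ, Real.exp (-(initialSum k d)) * Real.exp (-(initialSum l d)) =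
      ∏ j : Fin n, Real.exp (-((((if (j : ℕ) < k then 1 else 0) +
        (if (j : ℕ) < l then 1 else 0) : ℝ)) * d j)) := by
    intro d
    rw [← Real.exp_add, ← Real.exp_sum, initialSum, initialSum, Finset.sum_filter,
      Finset.sum_filter, ← neg_add, ← Finset.sum_add_distrib, Finset.sum_neg_distrib]
    simp only [add_mul, ite_mul, one_mul, zero_mul]
  simp only [h]
  rw [expSpacings, integral_fintype_prod_eq_prod (𝕜 := ℝ) (E := fun _ : Fin n => ℝ)
    (fun (j : Fin n) x => Real.exp (-((((if (j : ℕ) < k then 1 else 0) +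
        (if (j : ℕ) < l then 1 else 0) : ℝ)) * x)))]
  rw [Finset.prod_congr rfl fun j _ => integral_exp_neg_expMeasure (expRate_pos one_pos j)
    (by positivity)]
  simp only [mul_one]
  rw [Fin.prod_univ_eq_prod_range (fun x => ((n : ℝ) - x) / ((n : ℝ) - x +
        ((if x < k then 1 else 0) + (if x < l then 1 else 0)))), prod_range_exp_transform hkl le_rfl,
    min_eq_right hl, min_eq_right (hkl.trans hl)]

theorem integral_exp_neg_initialSum_single {n l : ℕ} (hl : l ≤ n) :
    ∫ d : Fin n → ℝ, Real.exp (-(initialSum l d)) ∂expSpacings n 1 =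
      ((n : ℝ) + 1 - l) / (n + 1) := by
  -- For k = 0 the first sum is empty, so its exponential factor is 1.
  have h := integral_exp_neg_initialSum (Nat.zero_le l) hl
  simp only [initialSum, not_lt_zero, Finset.filter_false, Finset.sum_empty, neg_zero,
    Real.exp_zero, one_mul] at h
  unfold initialSum
  rw [h]
  push_cast
  field_simp
  ring

theorem memLp_exp_neg_initialSum {n k : ℕ} (hk : k ≤ n) :
    MemLp (fun d : Fin n → ℝ => Real.exp (-(initialSum k d))) 2 (expSpacings n 1) := by
  have hk' : (k : ℝ) ≤ n := by exact_mod_cast hk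
  rw [memLp_two_iff_integrable_sq
    (by exact (Real.measurable_exp.comp (measurable_initialSum k).neg).aestronglyMeasurable)]
  refine by_contra fun h => ?_
  have h1 := integral_exp_neg_initialSum le_rfl hk
  simp only [sq] at h
  rw [integral_undef h] at h1
  have h2 : 0 < (n : ℝ) + 1 - k := by linarith
  have h3 : 0 < (n : ℝ) + 2 - k := by linarith
  have : 0 < ((n : ℝ) + 1 - k) * ((n : ℝ) + 2 - k) / ((n + 1) * (n + 2)) := by positivity
  linarith

theorem covariance_exp_neg_initialSum {n k l : ℕ} (hkl : k ≤ l) (hl : l ≤ n) :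
    covariance (fun d : Fin n → ℝ => 1 - Real.exp (-(initialSum k d)))
        (fun d => 1 - Real.exp (-(initialSum l d))) (expSpacings n 1) =
      (k : ℝ) * ((n : ℝ) + 1 - l) / ((n + 1) ^ 2 * (n + 2)) := by
  have := isProbabilityMeasure_expSpacings n one_pos
  have hk := hkl.trans hl
  have hX := memLp_exp_neg_initialSum hk
  have hY := memLp_exp_neg_initialSum hl
  rw [covariance_const_sub_left (hX.integrable (by norm_num)),
    covariance_const_sub_right (hY.integrable (by norm_num)), neg_neg, covariance_eq_sub hX hY]
  simp only [Pi.mul_apply]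
  rw [integral_exp_neg_initialSum hkl hl, integral_exp_neg_initialSum_single hk,
    integral_exp_neg_initialSum_single hl]
  field_simp
  ring

/-! ### The monotonicity inequality -/

/-- `c ^ 2` times the variance of the `k`-th order statistic of an exponential sample. -/
noncomputable def expOrderVariance (n k : ℕ) : ℝ := ∑ j ∈ Finset.range k, 1 / ((n : ℝ) - j) ^ 2

theorem expOrderVariance_pos {n k : ℕ} (hk : 1 ≤ k) (hkn : k ≤ n) : 0 < expOrderVariance n k := by
  refine Finset.sum_pos (fun j hj => ?_) ⟨0, Finset.mem_range.2 hk⟩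
  have : (j : ℝ) < n := by exact_mod_cast (Finset.mem_range.1 hj).trans_le hkn
  have : 0 < (n : ℝ) - j := by linarith
  positivity

/-- Telescoping 1/(n-j)² < 1/((n-j)(n-j-1)) gives only k/((n-k)n), which is too weak. The sharper
bound works because its increment from k to k + 1 exceeds 1/(n-k)² by an explicit positive fraction.
-/
theorem expOrderVariance_lt {n k : ℕ} (hk : 1 ≤ k) (hkn : k < n) :
    expOrderVariance n k < k / (((n : ℝ) - k) * (n + 1)) := by
  induction k, hk using Nat.le_induction with
  | base =>
    have : (1 : ℝ) < n := by exact_mod_cast hkn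
    have : 0 < (n : ℝ) - 1 := by linarith
    simp only [expOrderVariance, Finset.range_one, Finset.sum_singleton, Nat.cast_zero, sub_zero,
      Nat.cast_one]
    rw [div_lt_div_iff₀ (by positivity) (by positivity)]
    nlinarith
  | succ k hk ih =>
    have hm : (k : ℝ) + 1 < n := by exact_mod_cast hkn
    have h1 := ih (by omega)
    rw [expOrderVariance, Finset.sum_range_succ]
    refine (add_lt_add_left h1 _).trans ?_
    push_cast
    obtain ⟨m, hm'⟩ : ∃ m : ℝ, m = n - k := ⟨_, rfl⟩
    have hn : (n : ℝ) = m + k := by linarith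
    have hm1 : 0 < m - 1 := by linarith
    have hm0 : 0 < m := by linarith
    have hk0 : (0 : ℝ) ≤ k := by positivity
    rw [show (n : ℝ) - (k + 1) = m - 1 by linarith, ← hm', hn, ← sub_pos]
    have : ((k : ℝ) + 1) / ((m - 1) * (m + k + 1)) - (k / (m * (m + k + 1)) + 1 / m ^ 2) =
        (k + 1) / (m ^ 2 * (m - 1) * (m + k + 1)) := by
      have : m + k + 1 ≠ 0 := by positivity
      field_simp
      ring
    rw [this]
    positivity

/-- Since (n+1-k)/k - (n-k)/(k+1) = (n+1)/(k(k+1)), the claim rearranges exactly to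
`expOrderVariance_lt`. -/
theorem expOrderVariance_mul_lt_succ {n k : ℕ} (hk : 1 ≤ k) (hkn : k < n) :
    expOrderVariance n k * ((n : ℝ) + 1 - k) / k <
      expOrderVariance n (k + 1) * ((n : ℝ) + 1 - (k + 1 : ℕ)) / (k + 1 : ℕ) := by
  have h := expOrderVariance_lt hk hkn
  have hk0 : (0 : ℝ) < k := by exact_mod_cast hk
  have hn : 0 < (n : ℝ) - k := sub_pos.2 (by exact_mod_cast hkn)
  rw [lt_div_iff₀ (by positivity)] at h
  have hs : expOrderVariance n (k + 1) = expOrderVariance n k + 1 / ((n : ℝ) - k) ^ 2 :=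
    Finset.sum_range_succ _ _
  rw [hs]
  push_cast
  rw [div_lt_div_iff₀ hk0 (by positivity)]
  have h2 : 1 / ((n : ℝ) - k) ^ 2 * ((n : ℝ) - k) ^ 2 = 1 := by field_simp
  generalize 1 / ((n : ℝ) - k) ^ 2 = v at h2 ⊢
  generalize expOrderVariance n k = a at h ⊢
  -- The extra factor n - k makes v (n-k)² = 1 usable; it is cancelled next.
  have : v * ((n : ℝ) - k) * k * (n - k) > a * (n + 1) * (n - k) := by nlinarith
  have := lt_of_mul_lt_mul_right this hn.le
  nlinarith

theorem expOrderVariance_mul_lt {n k l : ℕ} (hk : 1 ≤ k) (hkl : k < l) (hl : l ≤ n) :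
    expOrderVariance n k * ((n : ℝ) + 1 - k) / k <
      expOrderVariance n l * ((n : ℝ) + 1 - l) / l := by
  induction l, hkl using Nat.le_induction with
  | base => exact expOrderVariance_mul_lt_succ hk hl
  | succ l hkl ih => exact (ih (by omega)).trans (expOrderVariance_mul_lt_succ (by omega) hl)

/-! ### Transfer from spacings to order statistics -/

theorem covariance_eval_of_hasLaw_map {Ω α : Type*} [MeasurableSpace Ω] [MeasurableSpace α]
    {μ : Measure Ω} {Q : Measure α} {n : ℕ} {V : Ω → Fin n → ℝ} {Φ : α → Fin n → ℝ}
    (hΦ : Measurable Φ) (hV : HasLaw V (Q.map Φ) μ) (i j : Fin n) :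
    covariance (fun ω => V ω i) (fun ω => V ω j) μ =
      covariance (fun d => Φ d i) (fun d => Φ d j) Q := by
  rw [hV.covariance_fun_comp (f := fun x => x i) (g := fun x => x j)
      (measurable_pi_apply i).aemeasurable (measurable_pi_apply j).aemeasurable,
    covariance_map_fun (measurable_pi_apply i).aestronglyMeasurable
      (measurable_pi_apply j).aestronglyMeasurable hΦ.aemeasurable]

theorem memLp_eval_of_hasLaw_map {Ω α : Type*} [MeasurableSpace Ω] [MeasurableSpace α]
    {μ : Measure Ω} {Q : Measure α} {n : ℕ} {V : Ω → Fin n → ℝ} {Φ : α → Fin n → ℝ}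
    (hΦ : Measurable Φ) (hV : HasLaw V (Q.map Φ) μ) (i : Fin n)
    (h : MemLp (fun d => Φ d i) 2 Q) : MemLp (fun ω => V ω i) 2 μ := by
  have h1 : MemLp (fun x : Fin n → ℝ => x i) 2 (Q.map Φ) :=
    (memLp_map_measure_iff (measurable_pi_apply i).aestronglyMeasurable hΦ.aemeasurable).2 h
  rw [← hV.map_eq] at h1
  exact (memLp_map_measure_iff (measurable_pi_apply i).aestronglyMeasurable
    hV.aemeasurable).1 h1

theorem hasLaw_sortedSample {Ω : Type*} [MeasurableSpace Ω] {μ : Measure Ω} {n : ℕ}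
    {ρ : Measure ℝ} {X : Fin n → Ω → ℝ} (hX : iIndepFun X μ) (hlaw : ∀ i, HasLaw (X i) ρ μ) :
    HasLaw (fun ω => sortedSample fun i => X i ω)
      ((Measure.pi fun _ : Fin n => ρ).map sortedSample) μ :=
  HasLaw.fun_comp (measurable_sortedSample.measurePreserving _).hasLaw (hX.hasLaw_pi hlaw)

/-- The permutation sorting x also puts the values g (x i) in order. It may break new ties
differently from their own sort, but the sorted tuple is the same. -/
theorem sortedSample_comp_monotone {n : ℕ} {g : ℝ → ℝ} (hg : Monotone g) (x : Fin n → ℝ) :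
    sortedSample (fun i => g (x i)) = fun i => g (sortedSample x i) :=
  (Tuple.comp_sort_eq_comp_iff_monotone (f := fun i => g (x i)) (σ := Tuple.sort x)).2
    (hg.comp (Tuple.monotone_sort x)) |>.symm

theorem map_sortedSample_uniform (n : ℕ) :
    (Measure.pi fun _ : Fin n => volume.restrict (Set.Icc (0 : ℝ) 1)).map sortedSample =
      (expSpacings n 1).map fun d i => 1 - Real.exp (-(partialSums d i)) := by
  have := isProbabilityMeasure_expMeasure one_pos
  have hg : Measurable fun x : ℝ => 1 - Real.exp (-x) := by fun_prop
  have hG : Measurable fun (x : Fin n → ℝ) i => 1 - Real.exp (-(x i)) := by fun_prop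
  have : IsProbabilityMeasure ((expMeasure 1).map fun x => 1 - Real.exp (-x)) :=
    Measure.isProbabilityMeasure_map hg.aemeasurable
  have hmono : Monotone fun x : ℝ => 1 - Real.exp (-x) := fun x y hxy =>
    sub_le_sub_left (Real.exp_le_exp.2 (neg_le_neg hxy)) 1
  rw [← map_expMeasure_one_eq_uniform, ← Measure.pi_map_pi fun _ => hg.aemeasurable,
    Measure.map_map measurable_sortedSample hG,
    show sortedSample ∘ (fun (x : Fin n → ℝ) i => 1 - Real.exp (-(x i))) =
      (fun x i => 1 - Real.exp (-(x i))) ∘ sortedSample from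
      funext fun x => sortedSample_comp_monotone hmono x,
    ← Measure.map_map hG measurable_sortedSample, map_sortedSample_expMeasure n one_pos,
    Measure.map_map hG measurePreserving_partialSums.measurable]
  rfl

section Exponential

variable {Ω : Type*} [MeasurableSpace Ω] {μ : Measure Ω} {n : ℕ} {c : ℝ}
  {X : Fin n → Ω → ℝ}

theorem covariance_orderStatistic_exp (hc : 0 < c) (hX : iIndepFun X μ)
    (hlaw : ∀ i, HasLaw (X i) (expMeasure c) μ) {k l : ℕ} (hk : 1 ≤ k) (hl : 1 ≤ l) (hkl : k ≤ l)
    (hln : l ≤ n) (hkn : k ≤ n) :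
    covariance (orderStatistic X k hk hkn) (orderStatistic X l hl hln) μ =
      expOrderVariance n k / c ^ 2 := by
  have hV := hasLaw_sortedSample hX hlaw
  rw [map_sortedSample_expMeasure n hc] at hV
  refine (covariance_eval_of_hasLaw_map measurePreserving_partialSums.measurable hV
    ⟨k - 1, by omega⟩ ⟨l - 1, by omega⟩).trans ?_
  simp only [partialSums_eq_initialSum hk, partialSums_eq_initialSum hl]
  exact covariance_initialSum hc hkl hln

theorem memLp_orderStatistic_exp (hc : 0 < c) (hX : iIndepFun X μ)
    (hlaw : ∀ i, HasLaw (X i) (expMeasure c) μ) {k : ℕ} (hk : 1 ≤ k) (hkn : k ≤ n) :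
    MemLp (orderStatistic X k hk hkn) 2 μ := by
  have hV := hasLaw_sortedSample hX hlaw
  rw [map_sortedSample_expMeasure n hc] at hV
  refine memLp_eval_of_hasLaw_map measurePreserving_partialSums.measurable hV ⟨k - 1, by omega⟩ ?_
  simp only [partialSums_eq_initialSum hk]
  exact memLp_initialSum hc k

theorem variance_orderStatistic_exp (hc : 0 < c) (hX : iIndepFun X μ)
    (hlaw : ∀ i, HasLaw (X i) (expMeasure c) μ) {k : ℕ} (hk : 1 ≤ k) (hkn : k ≤ n) :
    variance (orderStatistic X k hk hkn) μ = expOrderVariance n k / c ^ 2 := by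
  rw [← covariance_self (memLp_orderStatistic_exp hc hX hlaw hk hkn).aemeasurable,
    covariance_orderStatistic_exp hc hX hlaw hk hk le_rfl hkn hkn]

end Exponential

section Uniform

variable {Ω : Type*} [MeasurableSpace Ω] {μ : Measure Ω} {n : ℕ} {U : Fin n → Ω → ℝ}

theorem measurable_one_sub_exp_neg_partialSums {n : ℕ} :
    Measurable fun (d : Fin n → ℝ) i => 1 - Real.exp (-(partialSums d i)) :=
  measurable_pi_lambda _ fun i => measurable_const.sub
    ((measurable_pi_apply i).comp measurePreserving_partialSums.measurable).neg.exp

theorem hasLaw_of_isUniform {Y : Ω → ℝ} (h : pdf.IsUniform Y (Set.Icc (0 : ℝ) 1) μ volume) :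
    HasLaw Y (volume.restrict (Set.Icc (0 : ℝ) 1)) μ where
  aemeasurable := h.aemeasurable (by simp) (by simp)
  map_eq := by
    have : μ.map Y = cond volume (Set.Icc (0 : ℝ) 1) := h
    rw [this, ProbabilityTheory.cond]
    simp

theorem hasLaw_sortedSample_uniform (hU : iIndepFun U μ)
    (hlaw : ∀ i, pdf.IsUniform (U i) (Set.Icc (0 : ℝ) 1) μ volume) :
    HasLaw (fun ω => sortedSample fun i => U i ω)
      ((expSpacings n 1).map fun d i => 1 - Real.exp (-(partialSums d i))) μ := by
  rw [← map_sortedSample_uniform]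
  exact hasLaw_sortedSample hU fun i => hasLaw_of_isUniform (hlaw i)

theorem covariance_orderStatistic_uniform (hU : iIndepFun U μ)
    (hlaw : ∀ i, pdf.IsUniform (U i) (Set.Icc (0 : ℝ) 1) μ volume) {k l : ℕ} (hk : 1 ≤ k)
    (hl : 1 ≤ l) (hkl : k ≤ l) (hln : l ≤ n) (hkn : k ≤ n) :
    covariance (orderStatistic U k hk hkn) (orderStatistic U l hl hln) μ =
      (k : ℝ) * ((n : ℝ) + 1 - l) / ((n + 1) ^ 2 * (n + 2)) := by
  refine (covariance_eval_of_hasLaw_map measurable_one_sub_exp_neg_partialSums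
    (hasLaw_sortedSample_uniform hU hlaw) ⟨k - 1, by omega⟩ ⟨l - 1, by omega⟩).trans ?_
  simp only [partialSums_eq_initialSum hk, partialSums_eq_initialSum hl]
  exact covariance_exp_neg_initialSum hkl hln

theorem memLp_orderStatistic_uniform (hU : iIndepFun U μ)
    (hlaw : ∀ i, pdf.IsUniform (U i) (Set.Icc (0 : ℝ) 1) μ volume) {k : ℕ} (hk : 1 ≤ k)
    (hkn : k ≤ n) : MemLp (orderStatistic U k hk hkn) 2 μ := by
  refine memLp_eval_of_hasLaw_map measurable_one_sub_exp_neg_partialSums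
    (hasLaw_sortedSample_uniform hU hlaw) ⟨k - 1, by omega⟩ ?_
  have := isProbabilityMeasure_expSpacings n one_pos
  simp only [partialSums_eq_initialSum hk]
  exact (memLp_const 1).sub (memLp_exp_neg_initialSum hkn)

theorem variance_orderStatistic_uniform (hU : iIndepFun U μ)
    (hlaw : ∀ i, pdf.IsUniform (U i) (Set.Icc (0 : ℝ) 1) μ volume) {k : ℕ} (hk : 1 ≤ k)
    (hkn : k ≤ n) : variance (orderStatistic U k hk hkn) μ =
      (k : ℝ) * ((n : ℝ) + 1 - k) / ((n + 1) ^ 2 * (n + 2)) := by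
  rw [← covariance_self (memLp_orderStatistic_uniform hU hlaw hk hkn).aemeasurable,
    covariance_orderStatistic_uniform hU hlaw hk hk le_rfl hkn hkn]

end Uniform

/-! ### Comparison of the two correlations -/

theorem div_sqrt_mul_sqrt_eq_sqrt {x a b : ℝ} (hx : 0 ≤ x) (ha : 0 ≤ a) :
    x / (Real.sqrt a * Real.sqrt b) = Real.sqrt (x ^ 2 / (a * b)) := by
  rw [← Real.sqrt_mul ha, Real.sqrt_div (sq_nonneg x), Real.sqrt_sq hx]
theorem theorem2 {Ω Ω' : Type*} [MeasurableSpace Ω] [MeasurableSpace Ω']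
    (μ : Measure Ω) [IsProbabilityMeasure μ] (ν : Measure Ω') [IsProbabilityMeasure ν]
    (n k t : ℕ) (hn : 2 ≤ n) (hk : 1 ≤ k) (ht : 1 ≤ t) (hkt : k + t ≤ n)
    -- an i.i.d. exponential sample with an arbitrary rate `c > 0`
    (c : ℝ) (hc : 0 < c) (X : Fin n → Ω → ℝ) (hXindep : iIndepFun X μ)
    (hXlaw : ∀ i, HasLaw (X i) (expMeasure c) μ)
    -- an i.i.d. sample from the uniform distribution on `[0, 1]`
    (U : Fin n → Ω' → ℝ) (hUindep : iIndepFun U ν)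
    (hUlaw : ∀ i, pdf.IsUniform (U i) (Set.Icc (0 : ℝ) 1) ν volume) :
    -- all four order statistics have finite positive variance
    (HasPositiveFiniteVariance (orderStatistic X k hk (Nat.le_of_add_right_le hkt)) μ ∧
      HasPositiveFiniteVariance
        (orderStatistic X (k + t) (Nat.le_add_right_of_le hk) hkt) μ ∧
      HasPositiveFiniteVariance (orderStatistic U k hk (Nat.le_of_add_right_le hkt)) ν ∧
      HasPositiveFiniteVariance
        (orderStatistic U (k + t) (Nat.le_add_right_of_le hk) hkt) ν) ∧
    -- the exponential correlation is strictly less than the uniform one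
    correlationCoefficient (orderStatistic X k hk (Nat.le_of_add_right_le hkt))
        (orderStatistic X (k + t) (Nat.le_add_right_of_le hk) hkt) μ <
      correlationCoefficient (orderStatistic U k hk (Nat.le_of_add_right_le hkt))
        (orderStatistic U (k + t) (Nat.le_add_right_of_le hk) hkt) ν ∧
    -- the value of the uniform correlation
    correlationCoefficient (orderStatistic U k hk (Nat.le_of_add_right_le hkt))
        (orderStatistic U (k + t) (Nat.le_add_right_of_le hk) hkt) ν =
      Real.sqrt (((k : ℝ) * ((n : ℝ) + 1 - k - t)) / (((k : ℝ) + t) * ((n : ℝ) + 1 - k))) := by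

  have hkn : k ≤ n := Nat.le_of_add_right_le hkt
  have hl : 1 ≤ k + t := Nat.le_add_right_of_le hk
  have hkR : (0 : ℝ) < k := by exact_mod_cast hk
  have htR : (0 : ℝ) < t := by exact_mod_cast ht
  have hnR : (k : ℝ) + t ≤ n := by exact_mod_cast hkt
  have h1 : 0 < (n : ℝ) + 1 - k := by linarith
  have h2 : 0 < (n : ℝ) + 1 - (k + t : ℕ) := by push_cast; linarith
  have h2' : 0 < (n : ℝ) + 1 - k - t := by linarith
  have hA := expOrderVariance_pos hk hkn
  have hB := expOrderVariance_pos hl hkt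
  have hU : correlationCoefficient (orderStatistic U k hk hkn)
      (orderStatistic U (k + t) hl hkt) ν =
      Real.sqrt (((k : ℝ) * ((n : ℝ) + 1 - k - t)) / (((k : ℝ) + t) * ((n : ℝ) + 1 - k))) := by
    rw [correlationCoefficient, covariance_orderStatistic_uniform hUindep hUlaw hk hl
      (Nat.le_add_right k t) hkt hkn, variance_orderStatistic_uniform hUindep hUlaw hk hkn,
      variance_orderStatistic_uniform hUindep hUlaw hl hkt,
      div_sqrt_mul_sqrt_eq_sqrt (by positivity) (by positivity)]
    congr 1
    push_cast
    rw [← sub_sub]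
    field_simp
  have hX : correlationCoefficient (orderStatistic X k hk hkn)
      (orderStatistic X (k + t) hl hkt) μ =
      Real.sqrt (expOrderVariance n k / expOrderVariance n (k + t)) := by
    rw [correlationCoefficient, covariance_orderStatistic_exp hc hXindep hXlaw hk hl
      (Nat.le_add_right k t) hkt hkn, variance_orderStatistic_exp hc hXindep hXlaw hk hkn,
      variance_orderStatistic_exp hc hXindep hXlaw hl hkt,
      div_sqrt_mul_sqrt_eq_sqrt (by positivity) (by positivity)]
    congr 1
    field_simp
  refine ⟨⟨⟨memLp_orderStatistic_exp hc hXindep hXlaw hk hkn, ?_⟩,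
    ⟨memLp_orderStatistic_exp hc hXindep hXlaw hl hkt, ?_⟩,
    ⟨memLp_orderStatistic_uniform hUindep hUlaw hk hkn, ?_⟩,
    ⟨memLp_orderStatistic_uniform hUindep hUlaw hl hkt, ?_⟩⟩, ?_, hU⟩
  · rw [variance_orderStatistic_exp hc hXindep hXlaw hk hkn]
    positivity
  · rw [variance_orderStatistic_exp hc hXindep hXlaw hl hkt]
    positivity
  · rw [variance_orderStatistic_uniform hUindep hUlaw hk hkn]
    positivity
  · rw [variance_orderStatistic_uniform hUindep hUlaw hl hkt]
    positivity
  · rw [hX, hU]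
    refine Real.sqrt_lt_sqrt (by positivity) ?_
    -- Cross-multiplied, this is the required inequality between the two radicands.
    have h := expOrderVariance_mul_lt hk (Nat.lt_add_of_pos_right ht) hkt
    rw [div_lt_div_iff₀ hkR (by positivity)] at h
    rw [div_lt_div_iff₀ hB (by positivity)]
    push_cast at h
    nlinarith
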